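/- **Setting.** Let $\mathbf X,\mathbf A$ be non-empty Borel subsets of Polish spaces, $\alpha>0$, and let $J\ge 0$ be an integer. Let $\phi:\mathbf X\times[0,\infty)\to\mathbf X$ be a Borel-measurable semiflow: $\phi(x,0)=x$, $\phi(x,s+t)=\phi(\phi(x,s),t)$ and $\lim_{t\downarrow0}\phi(\phi(x,s),t)=\phi(x,s)$. Let $l:\mathbf X\times\mathbf A\to\mathbf X$, $C^g_j:\mathbf X\to[0,\infty]$ and $C^I_j:\mathbf X\times\mathbf A\to[0,\infty]$, $j=0,\dots,J$, be Borel-measurable. Put $\mathbf X_\Delta=\mathbf X\cup\{\Delta\}$ with $\Delta$ an isolated point, and $\mathbf B=[0,\infty]\times\mathbf A$. Consider the Markov decision process with state space $\mathbf X_\Delta$, action space $\mathbf B$, transition law $$Q(dy|x,(\theta,a))=e^{-\alpha\theta}\delta_{l(\phi(x,\theta),a)}(dy)+(1-e^{-\alpha\theta})\delta_\Delta(dy)\quad(x\in\mathbf X,\ \theta<\infty),$$ $Q(\cdot|x,(\theta,a))=\delta_\Delta$ otherwise, and one-step costs $$\bar C_j(x,(\theta,a))=\int_0^\theta e^{-\alpha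 t}C^g_j(\phi(x,t))\,dt+e^{-\alpha\theta}C^I_j(\phi(x,\theta),a)\quad(x\in\mathbf X),\qquad \bar C_j(\Delta,\cdot)=0,$$ where the last summand is $0$ if $\theta=\infty$. A strategy $\pi$ is a sequence of stochastic kernels on $\mathbf B$ given the history $(x_0,b_1,x_1,\dots,x_{i-1})$, $i\ge1$; a measurable map $f:\mathbf X_\Delta\to\mathbf B$ is identified with the deterministic stationary strategy that applies $f(x_{i-1})$ at each step. For an initial state $x$ let $\mathsf E^\pi_x$ be the expectation under the resulting law of $(X_0,B_1,X_1,B_2,\dots)$. For measurable $c\ge0$ put $\mathcal V(x,\pi,c)=\mathsf E^\pi_x\big[\sum_{i\ge1}c(X_{i-1},B_i)\big]$ and $\mathcal V^*(x,c)=\inf_\pi\mathcal V(x,\pi,c)$, the infimum being over all strategies. Let $$\mathbf V=\Big\{x\in\mathbf X_\Delta:\ \mathcal V^*\big(x,\textstyle\sum_{j=0}^J\bar C_j\big)>0\Big\},\qquad \mathbf V^c=\mathbf X_\Delta\setminus\mathbf V .$$ **Assumptions.** (Semicontinuity) $\mathbf B$ is compact, $(x,b)\mapsto\int u(y)\,Q(dy|x,b)$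 is continuous for every bounded continuous $u$ on $\mathbf X_\Delta$, and each $\bar C_j$ is lower semicontinuous on $\mathbf X_\Delta\times\mathbf B$. (Costs) There is $\delta>0$ with $C^I_0(x,a)\ge\delta$ for all $(x,a)\in\mathbf X\times\mathbf A$, and $\max_j\sup_{x}C^g_j(x)+\max_j\sup_{(x,a)}C^I_j(x,a)<\infty$. **Claim.** Let $\bar g\in[0,\infty)^J$, write $C_{\bar g}=\bar C_0+\sum_{j=1}^J g_j\bar C_j$, and let $W^*_{\bar g}(x)=\mathcal V^*(x,C_{\bar g})$ for $x\in\mathbf V$. (a) $W^*_{\bar g}$ is bounded, non-negative and lower semicontinuous on $\mathbf V$, and it is feasible for the dual program, i.e. it is a bounded measurable function $W$ on $\mathbf V$ with $$C_{\bar g}(x,b)+\int_{\mathbf V}W(y)\,Q(dy|x,b)-W(x)\ge0,\qquad (x,b)\in\mathbf V\times\mathbf B.$$ (b) $W^*_{\bar g}$ is the unique bounded lower semicontinuous function on $\mathbf V$ that satisfies $$W(x)=\inf_{b\in\mathbf B}\Big\{C_{\bar g}(x,b)+\int_{\mathbf V}W(y)\,Q(dy|x,b)\Big\},\qquad x\in\mathbf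 V .\tag{$*$}$$ Moreover, let $f^*:\mathbf X_\Delta\to\mathbf B$ be any measurable map with $\mathcal V(x,f^*,\sum_{j=0}^J\bar C_j)=\mathcal V^*(x,\sum_{j=0}^J\bar C_j)$ for all $x\in\mathbf V^c$. If a bounded measurable function $W$ on $\mathbf V$ satisfies $(*)$, and $\hat f:\mathbf V\to\mathbf B$ is a measurable map such that for every $x\in\mathbf V$ the infimum in $(*)$ is attained at $b=\hat f(x)$, then $\hat f$, extended by $\hat f(x):=f^*(x)$ for $x\in\mathbf V^c$, is a measurable map on $\mathbf X_\Delta$, and the deterministic stationary strategy $\hat f$ is uniformly optimal: $$\mathcal V(x,\hat f,\bar C_0)+\sum_{j=1}^J g_j\mathcal V(x,\hat f,\bar C_j)=\mathcal V^*(x,C_{\bar g}),\qquad x\in\mathbf X_\Delta .$$ -/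

import Mathlib

open MeasureTheory ProbabilityTheory Filter Topology
open scoped ENNReal NNReal BoundedContinuousFunction

namespace ImpulseControl

/-! ### Generic Markov decision processes

`Y` is the state space, `B` the action space, `Q` the transition law. -/

section Generic

variable {Y B : Type*} [MeasurableSpace Y] [MeasurableSpace B]

/-- Histories `(x₀, b₁, x₁, …, bₙ, xₙ)`: the `n` pairs `(x₀, b₁), …, (xₙ₋₁, bₙ)`, then `xₙ`. -/
abbrev History (Y B : Type*) (n : ℕ) : Type _ := (Fin n → Y × B) × Y

/-- A control strategy: `kernel n` is the (randomized, history dependent) rule that selects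
the action `bₙ₊₁` given the history `(x₀, b₁, …, bₙ, xₙ)`. -/
structure Strategy (Y B : Type*) [MeasurableSpace Y] [MeasurableSpace B] where
  kernel : (n : ℕ) → Kernel (History Y B n) B
  markov : ∀ n, IsMarkovKernel (kernel n)

/-- The deterministic stationary strategy: apply `f x` whenever the current state is `x`. -/
noncomputable def Strategy.ofMap (f : Y → B) (hf : Measurable f) : Strategy Y B where
  kernel n := Kernel.deterministic (fun h : History Y B n => f h.2) (hf.comp measurable_snd)
  markov _ := inferInstance

/-- The pairs `(x₀, b₁), …, (xₙ, bₙ₊₁)` followed by the next state `xₙ₊₁`, as a history. -/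
def toHistory (n : ℕ) (p : ((_ : Finset.Iic n) → Y × B) × Y) : History Y B (n + 1) :=
  (fun i => p.1 ⟨i.1, Finset.mem_Iic.2 (Nat.lt_succ_iff.1 i.2)⟩, p.2)

lemma measurable_toHistory (n : ℕ) : Measurable (toHistory (Y := Y) (B := B) n) := by
  unfold toHistory
  fun_prop

/-- The conditional law of `(xₙ₊₁, bₙ₊₂)` given `(x₀, b₁), …, (xₙ, bₙ₊₁)`: first `xₙ₊₁` has law
`Q(· | xₙ, bₙ₊₁)`, then `bₙ₊₂` has the law that the strategy prescribes. -/
noncomputable def stepKernel (Q : Kernel (Y × B) Y) (π : Strategy Y B) (n : ℕ) :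
    Kernel ((_ : Finset.Iic n) → Y × B) (Y × B) :=
  (Q.comap (fun h : (_ : Finset.Iic n) → Y × B => h ⟨n, Finset.mem_Iic.2 le_rfl⟩)
      (measurable_pi_apply _)) ⊗ₖ
    ((π.kernel (n + 1)).comap (toHistory n) (measurable_toHistory n))

instance (Q : Kernel (Y × B) Y) [IsMarkovKernel Q] (π : Strategy Y B) (n : ℕ) :
    IsMarkovKernel (stepKernel Q π n) := by
  have := π.markov (n + 1)
  unfold stepKernel
  infer_instance

/-- The law of `(x₀, b₁)` when the initial state is `x`. -/
noncomputable def initialLaw (π : Strategy Y B) (x : Y) : Measure (Y × B) :=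
  (Measure.dirac x) ⊗ₘ ((π.kernel 0).comap (fun y : Y => ((Fin.elim0, y) : History Y B 0))
    (measurable_const.prodMk measurable_id))

/-- The strategic measure of `π` given the initial state `x`, on the space of trajectories
`ω = ((x₀, b₁), (x₁, b₂), …)`, given by the Ionescu-Tulcea theorem. -/
noncomputable def strategicMeasure (Q : Kernel (Y × B) Y) [IsMarkovKernel Q]
    (π : Strategy Y B) (x : Y) : Measure (ℕ → Y × B) :=
  Kernel.trajMeasure (X := fun _ => Y × B) (initialLaw π x) (stepKernel Q π)

/-- The performance measure `𝒱(x, π, c) = E[∑ᵢ c(Xᵢ₋₁, Bᵢ)]`. -/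
noncomputable def perf (Q : Kernel (Y × B) Y) [IsMarkovKernel Q] (x : Y) (π : Strategy Y B)
    (c : Y × B → ℝ≥0∞) : ℝ≥0∞ :=
  ∫⁻ ω, ∑' i : ℕ, c (ω i) ∂(strategicMeasure Q π x)

/-- The Bellman function `𝒱*(x, c)`, the infimum of `𝒱(x, π, c)` over all strategies `π`. -/
noncomputable def value (Q : Kernel (Y × B) Y) [IsMarkovKernel Q] (x : Y)
    (c : Y × B → ℝ≥0∞) : ℝ≥0∞ :=
  ⨅ π : Strategy Y B, perf Q x π c

/-- Semicontinuity of a Markov decision process with costs `c j`. -/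
structure IsSemicontinuous [TopologicalSpace Y] [TopologicalSpace B] {ι : Type*}
    (Q : Kernel (Y × B) Y) (c : ι → Y × B → ℝ≥0∞) : Prop where
  compact_action : CompactSpace B
  weakly_continuous : ∀ u : Y →ᵇ ℝ, Continuous fun z : Y × B => ∫ y, u y ∂(Q z)
  lsc_cost : ∀ j, LowerSemicontinuous (c j)

end Generic

/-! ### The impulse control model -/

/-- Primitives of the impulse control model with `J` constraints. -/
structure Model (X A : Type*) [TopologicalSpace X] [MeasurableSpace X] [MeasurableSpace A]
    (J : ℕ) where
  /-- discount factor -/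
  α : ℝ
  α_pos : 0 < α
  /-- the semiflow -/
  φ : X × ℝ≥0 → X
  φ_measurable : Measurable φ
  φ_zero : ∀ x, φ (x, 0) = x
  φ_right : ∀ x s, Tendsto (fun t => φ (φ (x, s), t)) (𝓝[>] 0) (𝓝 (φ (x, s)))
  φ_add : ∀ x s t, φ (x, s + t) = φ (φ (x, s), t)
  /-- state after an impulse -/
  l : X × A → X
  l_measurable : Measurable l
  /-- running cost rates -/
  Cg : Fin (J + 1) → X → ℝ≥0∞
  Cg_measurable : ∀ j, Measurable (Cg j)
  /-- impulse costs -/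
  CI : Fin (J + 1) → X × A → ℝ≥0∞
  CI_measurable : ∀ j, Measurable (CI j)

/-- The state space with the isolated cemetery `Δ = Sum.inr ()` added. -/
abbrev State (X : Type*) : Type _ := X ⊕ Unit

/-- Actions `(θ, a)`: the waiting time `θ ∈ [0, ∞]` until the next impulse, and the impulse. -/
abbrev Act (A : Type*) : Type _ := ℝ≥0∞ × A

/-- `e^{-αθ}`, with value `0` at `θ = ∞`. -/
noncomputable def disc (α : ℝ) (θ : ℝ≥0∞) : ℝ≥0∞ :=
  if θ = ∞ then 0 else ENNReal.ofReal (Real.exp (-(α * θ.toReal)))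

lemma measurable_disc (α : ℝ) : Measurable (disc α) := by
  unfold disc
  refine Measurable.ite (measurableSet_singleton _) measurable_const ?_
  fun_prop

lemma disc_le_one {α : ℝ} (hα : 0 < α) (θ : ℝ≥0∞) : disc α θ ≤ 1 := by
  unfold disc
  split_ifs
  · exact zero_le_one
  · rw [ENNReal.ofReal_le_one, Real.exp_le_one_iff]
    have := mul_nonneg hα.le (ENNReal.toReal_nonneg (a := θ))
    linarith

namespace Model

variable {X A : Type*} [TopologicalSpace X] [MeasurableSpace X] [MeasurableSpace A] {J : ℕ}

/-- The transition law: from `x ∈ X` under `(θ, a)` with `θ < ∞` the state becomes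
`l(φ(x, θ), a)` with probability `e^{-αθ}` and `Δ` otherwise; `θ = ∞` leads to `Δ`, and `Δ` is
absorbing. -/
noncomputable def Qfun (M : Model X A J) : State X × Act A → Measure (State X)
  | (Sum.inl x, (θ, a)) =>
      if θ = ∞ then Measure.dirac (Sum.inr ())
      else disc M.α θ • Measure.dirac (Sum.inl (M.l (M.φ (x, θ.toNNReal), a))) +
        (1 - disc M.α θ) • Measure.dirac (Sum.inr ())
  | (Sum.inr _, _) => Measure.dirac (Sum.inr ())

lemma measurable_Qfun (M : Model X A J) : Measurable M.Qfun := by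
  have hl := M.l_measurable
  have hφ := M.φ_measurable
  have hd := measurable_disc M.α
  let e := MeasurableEquiv.sumProdDistrib X Unit (Act A)
  have h : Measurable (M.Qfun ∘ e.symm) := by
    refine measurable_fun_sum ?_ ?_
    · have h1 : Measurable fun p : X × Act A =>
          if p.2.1 = ∞ then Measure.dirac (Sum.inr () : State X)
          else disc M.α p.2.1 •
            Measure.dirac (Sum.inl (M.l (M.φ (p.1, p.2.1.toNNReal), p.2.2)) : State X) +
            (1 - disc M.α p.2.1) • Measure.dirac (Sum.inr () : State X) := by
        refine Measurable.ite (measurableSet_singleton (∞ : ℝ≥0∞) |>.preimage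
          (measurable_fst.comp measurable_snd)) measurable_const ?_
        refine Measure.measurable_of_measurable_coe _ fun s hs => ?_
        simp only [Measure.add_apply, Measure.smul_apply, smul_eq_mul]
        have h2 : Measurable fun p : X × Act A =>
            Measure.dirac (Sum.inl (M.l (M.φ (p.1, p.2.1.toNNReal), p.2.2)) : State X) s := by
          refine (Measure.measurable_coe hs).comp (Measure.measurable_dirac.comp ?_)
          exact measurable_inl.comp (hl.comp ((hφ.comp (measurable_fst.prodMk
            (measurable_fst.comp measurable_snd).ennreal_toNNReal)).prodMk
            (measurable_snd.comp measurable_snd)))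
        have h3 : Measurable fun p : X × Act A => disc M.α p.2.1 :=
          hd.comp (measurable_fst.comp measurable_snd)
        exact (h3.mul h2).add ((measurable_const.sub h3).mul measurable_const)
      exact h1
    · exact measurable_const
  have h' : M.Qfun = (M.Qfun ∘ e.symm) ∘ e := by
    ext p : 1
    simp
  rw [h']
  exact h.comp e.measurable

/-- The transition law as a stochastic kernel. -/
noncomputable def Q (M : Model X A J) : Kernel (State X × Act A) (State X) :=
  ⟨M.Qfun, M.measurable_Qfun⟩

instance (M : Model X A J) : IsMarkovKernel M.Q := by
  refine ⟨fun p => ⟨?_⟩⟩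
  change M.Qfun p Set.univ = 1
  rcases p with ⟨x | u, θ, a⟩
  · by_cases h : θ = ∞
    · simp [Qfun, h]
    · simp [Qfun, h, add_tsub_cancel_of_le (disc_le_one M.α_pos θ)]
  · simp [Qfun]

/-- The one-step costs `C̄ⱼ(x, (θ, a)) = ∫₀^θ e^{-αt} Cᵍⱼ(φ(x,t)) dt + e^{-αθ} Cᴵⱼ(φ(x,θ), a)`,
zero at `Δ`; the last summand is zero when `θ = ∞`. -/
noncomputable def cost (M : Model X A J) (j : Fin (J + 1)) : State X × Act A → ℝ≥0∞
  | (Sum.inl x, (θ, a)) =>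
      (∫⁻ t in {t : ℝ | 0 ≤ t ∧ ENNReal.ofReal t ≤ θ},
        ENNReal.ofReal (Real.exp (-(M.α * t))) * M.Cg j (M.φ (x, t.toNNReal))) +
      disc M.α θ * M.CI j (M.φ (x, θ.toNNReal), a)
  | (Sum.inr _, _) => 0

/-- The total cost `∑ⱼ C̄ⱼ`. -/
noncomputable def sumCost (M : Model X A J) (z : State X × Act A) : ℝ≥0∞ :=
  ∑ j, M.cost j z

/-- The weighted cost `C̄₀ + ∑_{j=1}^J gⱼ C̄ⱼ`. -/
noncomputable def lagCost (M : Model X A J) (g : Fin J → ℝ≥0) (z : State X × Act A) : ℝ≥0∞ :=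
  M.cost 0 z + ∑ j : Fin J, (g j : ℝ≥0∞) * M.cost j.succ z

/-- The set `V` of states from which the optimal total cost for `∑ⱼ C̄ⱼ` is positive. -/
def V (M : Model X A J) : Set (State X) := {x | 0 < value M.Q x M.sumCost}

/-- The impulse cost of the main functional is bounded away from zero, and all running cost
rates and impulse costs are bounded. -/
structure CostCondition (M : Model X A J) : Prop where
  impulse_pos : ∃ δ : ℝ≥0∞, 0 < δ ∧ ∀ x a, δ ≤ M.CI 0 (x, a)
  bounded : (⨆ j, ⨆ x, M.Cg j x) + (⨆ j, ⨆ z, M.CI j z) < ∞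

/-- `W*_g`, the restriction to `V` of the Bellman function of `C̄₀ + ∑ gⱼ C̄ⱼ`. -/
noncomputable def Wstar (M : Model X A J) (g : Fin J → ℝ≥0) (x : M.V) : ℝ≥0∞ :=
  value M.Q x (M.lagCost g)

/-- Bounded measurable functions on `V`. -/
def IsBddMeas (M : Model X A J) (W : M.V → ℝ) : Prop :=
  Measurable W ∧ ∃ K : ℝ, ∀ x, |W x| ≤ K

/-- `C̄₀(z) + ∑ⱼ gⱼ C̄ⱼ(z) + ∫_V W(y) Q(dy | z)` for `z = (x, b)`. -/
noncomputable def bellmanTerm (M : Model X A J) (g : Fin J → ℝ≥0) (W : M.V → ℝ)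
    (z : State X × Act A) : EReal :=
  (M.lagCost g z : EReal) +
    ((∫ y : M.V, W y ∂((M.Q z).comap (Subtype.val : M.V → State X)) : ℝ) : EReal)

/-- Feasible solutions of the dual program: bounded measurable `W` on `V` with
`C̄₀ + ∑ⱼ gⱼ C̄ⱼ + ∫_V W(y) Q(dy | x, b) - W(x) ≥ 0` for all `(x, b) ∈ V × B`. -/
def DualFeasible (M : Model X A J) (g : Fin J → ℝ≥0) (W : M.V → ℝ) : Prop :=
  M.IsBddMeas W ∧ ∀ (x : M.V) (b : Act A), 0 ≤ M.bellmanTerm g W (x, b) - (W x : EReal)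

/-- The Bellman equation on `V`. -/
def BellmanEq (M : Model X A J) (g : Fin J → ℝ≥0) (W : M.V → ℝ) : Prop :=
  ∀ x : M.V, (W x : EReal) = ⨅ b : Act A, M.bellmanTerm g W (x, b)

open scoped Classical in
/-- The map equal to `f` on `V` and to `fstar` on the complement of `V`. -/
noncomputable def glue (M : Model X A J) (f : M.V → Act A) (fstar : State X → Act A)
    (x : State X) : Act A :=
  if h : x ∈ M.V then f ⟨x, h⟩ else fstar x

end Model

end ImpulseControl

open ImpulseControl

/-!
Costs are nonnegative, so the total cost of a strategy is the sum of the expected costs of the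
single steps, and only two facts about trajectories are needed: `Q` is the conditional law of the
next state (`lintegral_state_succ`), and under a stationary strategy the action is a function of
the state (`lintegral_ofMap`). They turn one-step inequalities for a function `w` into comparisons
of `w` with total costs (`le_sum_add_lintegral`, `perf_ofMap_le`, `valueIter_le_perf`).

The Bellman function is the limit of value iteration (`Model.value_eq_bellmanFun`). Compactness of
the action space and lower semicontinuity give optimal actions in each state. From a fixed initial
state a deterministic choice of actions visits only countably many states, since a step leads
either to the cemetery or to one determined state; so such a choice can be altered elsewhere to
become measurable, and no measurable selection theorem is used.

Every impulse costs at least `δ > 0`. Hence a state `x` is outside `V` exactly if no cost at all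
arises when no impulse is ever applied, and then all weighted Bellman functions vanish at `x`: the
Bellman equation on the whole state space restricts to one on `V`. Moreover a bounded solution `W`
of the latter is nonnegative (`Model.nonneg_of_bellmanEq`). It is then a supersolution, hence above
value iteration, and a subsolution, hence below every total cost, because under a strategy of
finite cost the probability of survival tends to zero (`Model.le_perf_of_sub`). So
`W = W*_g` (`Model.eq_Wstar_of_bellmanEq`), for lower semicontinuous as well as for measurable `W`.
Finally, minimizers on `V` continued by `f*` attain the minimum in the Bellman equation everywhere
(`Model.glue_step_le_value`), which makes the resulting stationary strategy optimal.
-/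

namespace ImpulseControl

/-! ### Total costs in a Markov decision process -/

section Generic

variable {Y B : Type*} [MeasurableSpace Y] [MeasurableSpace B]
  {Q : Kernel (Y × B) Y}

/-- Value iteration: `valueIter Q c n` is the optimal cost over `n` steps. -/
noncomputable def valueIter (Q : Kernel (Y × B) Y) (c : Y × B → ℝ≥0∞) : ℕ → Y → ℝ≥0∞
  | 0, _ => 0
  | n + 1, y => ⨅ b, c (y, b) + ∫⁻ y', valueIter Q c n y' ∂(Q (y, b))

lemma valueIter_mono (Q : Kernel (Y × B) Y) (c : Y × B → ℝ≥0∞) : Monotone (valueIter Q c) := by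
  refine monotone_nat_of_le_succ fun n => ?_
  induction n with
  | zero => exact fun _ => zero_le
  | succ n ih =>
    intro y
    refine iInf_mono fun b => ?_
    gcongr with y'
    exact ih y'

lemma valueIter_le_of_super {c : Y × B → ℝ≥0∞} {w : Y → ℝ≥0∞}
    (h : ∀ y, ⨅ b, c (y, b) + ∫⁻ y', w y' ∂(Q (y, b)) ≤ w y) (n : ℕ) : valueIter Q c n ≤ w := by
  induction n with
  | zero => exact fun _ => zero_le
  | succ n ih =>
    refine fun y => le_trans (iInf_mono fun b => ?_) (h y)
    gcongr with y'
    exact ih y'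

variable [IsMarkovKernel Q]

instance isProbabilityMeasure_initialLaw (π : Strategy Y B) (x : Y) :
    IsProbabilityMeasure (initialLaw π x) := by
  have := π.markov 0
  unfold initialLaw
  infer_instance

lemma strategicMeasure_map_zero (π : Strategy Y B) (x : Y) :
    (strategicMeasure Q π x).map (fun ω => ω 0) = initialLaw π x := by
  have h : (fun ω : ℕ → Y × B => ω 0) =
      (fun z : (_ : Finset.Iic 0) → Y × B => z ⟨0, Finset.mem_Iic.2 le_rfl⟩) ∘
        Preorder.frestrictLe 0 := rfl
  have hid : (Kernel.traj (X := fun _ => Y × B) (stepKernel Q π) 0).map (Preorder.frestrictLe 0) =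
      Kernel.id := by
    rw [Kernel.traj_map_frestrictLe_of_le le_rfl]
    rfl
  rw [h, ← Measure.map_map (by fun_prop) (by fun_prop), strategicMeasure, Kernel.trajMeasure,
    Measure.map_comp _ _ (by fun_prop), hid, Measure.id_comp,
    Measure.map_map (by fun_prop) (by fun_prop)]
  exact Measure.map_id

lemma lintegral_strategicMeasure_zero (π : Strategy Y B) (x : Y) {h : Y × B → ℝ≥0∞}
    (hh : Measurable h) :
    ∫⁻ ω, h (ω 0) ∂(strategicMeasure Q π x) =
      ∫⁻ b, h (x, b) ∂(π.kernel 0 (Fin.elim0, x)) := by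
  have := π.markov 0
  rw [← lintegral_map hh (measurable_pi_apply 0), strategicMeasure_map_zero, initialLaw,
    Measure.lintegral_compProd hh, lintegral_dirac']
  · rfl
  · exact hh.lintegral_kernel_prod_right'

lemma lintegral_strategicMeasure_succ (π : Strategy Y B) (x : Y) (n : ℕ) {h : Y × B → ℝ≥0∞}
    (hh : Measurable h) :
    ∫⁻ ω, h (ω (n + 1)) ∂(strategicMeasure Q π x) =
      ∫⁻ ω, ∫⁻ y, ∫⁻ b, h (y, b)
        ∂(π.kernel (n + 1) (toHistory n (Preorder.frestrictLe n ω, y))) ∂(Q (ω n))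
        ∂(strategicMeasure Q π x) := by
  have := π.markov (n + 1)
  have e := Kernel.map_frestrictLe_trajMeasure_compProd_eq_map_trajMeasure
    (X := fun _ => Y × B) (μ₀ := initialLaw π x) (κ := stepKernel Q π) (a := n)
  have e2 := congrArg (fun μ => ∫⁻ p, h p.2 ∂μ) e
  rw [Measure.lintegral_compProd (by fun_prop), lintegral_map (by fun_prop) (by fun_prop),
    lintegral_map (by fun_prop) (by fun_prop)] at e2
  refine e2.symm.trans (lintegral_congr fun ω => ?_)
  rw [stepKernel, Kernel.lintegral_compProd _ _ _ hh]
  rfl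

/-- The initial state is deterministic. -/
lemma lintegral_state_zero (π : Strategy Y B) (x : Y) {w : Y → ℝ≥0∞} (hw : Measurable w) :
    ∫⁻ ω, w (ω 0).1 ∂(strategicMeasure Q π x) = w x := by
  have := π.markov 0
  rw [lintegral_strategicMeasure_zero π x (h := fun z => w z.1) (by fun_prop)]
  simp

/-- Under every strategy, `Q` is the conditional law of the next state. -/
lemma lintegral_state_succ (π : Strategy Y B) (x : Y) (n : ℕ) {w : Y → ℝ≥0∞}
    (hw : Measurable w) :
    ∫⁻ ω, w (ω (n + 1)).1 ∂(strategicMeasure Q π x) =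
      ∫⁻ ω, ∫⁻ y, w y ∂(Q (ω n)) ∂(strategicMeasure Q π x) := by
  have := π.markov (n + 1)
  rw [lintegral_strategicMeasure_succ π x n (h := fun z => w z.1) (by fun_prop)]
  simp

/-- Under a deterministic stationary strategy, the action is a function of the state. -/
lemma lintegral_ofMap (f : Y → B) (hf : Measurable f) (x : Y) (n : ℕ) {h : Y × B → ℝ≥0∞}
    (hh : Measurable h) :
    ∫⁻ ω, h (ω n) ∂(strategicMeasure Q (Strategy.ofMap f hf) x) =
      ∫⁻ ω, h ((ω n).1, f (ω n).1) ∂(strategicMeasure Q (Strategy.ofMap f hf) x) := by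
  have h1 : Measurable fun y => h (y, f y) := by fun_prop
  have h2 : ∀ y, Measurable fun b => h (y, b) := fun y => by fun_prop
  cases n with
  | zero =>
    rw [lintegral_state_zero _ x h1, lintegral_strategicMeasure_zero _ x hh]
    exact lintegral_dirac' _ (h2 x)
  | succ n =>
    rw [lintegral_state_succ _ x n h1, lintegral_strategicMeasure_succ _ x n hh]
    refine lintegral_congr fun ω => lintegral_congr fun y => ?_
    exact lintegral_dirac' _ (h2 y)

lemma perf_eq_tsum (π : Strategy Y B) (x : Y) {c : Y × B → ℝ≥0∞} (hc : Measurable c) :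
    perf Q x π c = ∑' i, ∫⁻ ω, c (ω i) ∂(strategicMeasure Q π x) :=
  lintegral_tsum fun i => (hc.comp (measurable_pi_apply i)).aemeasurable

/-- A function dominated by its image under every one-step operator is dominated by the expected
cost of the first `n` steps plus its own expectation after these steps. -/
lemma le_sum_add_lintegral (π : Strategy Y B) (x : Y) {c : Y × B → ℝ≥0∞} (hc : Measurable c)
    {w : Y → ℝ≥0∞} (hw : Measurable w) (h : ∀ y b, w y ≤ c (y, b) + ∫⁻ y', w y' ∂(Q (y, b)))
    (n : ℕ) :
    w x ≤ (∑ i ∈ Finset.range n, ∫⁻ ω, c (ω i) ∂(strategicMeasure Q π x)) +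
      ∫⁻ ω, w (ω n).1 ∂(strategicMeasure Q π x) := by
  induction n with
  | zero => simp [lintegral_state_zero π x hw]
  | succ n ih =>
    refine ih.trans ?_
    rw [Finset.sum_range_succ, add_assoc, lintegral_state_succ π x n hw,
      ← lintegral_add_left (by fun_prop)]
    gcongr with ω
    exact h _ _

/-- A stationary strategy whose one-step operator does not increase `w` has total cost at most
`w`. -/
lemma perf_ofMap_le (f : Y → B) (hf : Measurable f) {c : Y × B → ℝ≥0∞} (hc : Measurable c)
    {w : Y → ℝ≥0∞} (hw : Measurable w)
    (h : ∀ y, c (y, f y) + ∫⁻ y', w y' ∂(Q (y, f y)) ≤ w y) (x : Y) :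
    perf Q x (Strategy.ofMap f hf) c ≤ w x := by
  set μ := strategicMeasure Q (Strategy.ofMap f hf) x with hμ
  have hQ : Measurable fun z => ∫⁻ y', w y' ∂(Q z) := hw.lintegral_kernel
  have key : ∀ n, (∑ i ∈ Finset.range n, ∫⁻ ω, c (ω i) ∂μ) + ∫⁻ ω, w (ω n).1 ∂μ ≤ w x := by
    intro n
    induction n with
    | zero => simp [hμ, lintegral_state_zero _ x hw]
    | succ n ih =>
      refine le_trans ?_ ih
      rw [Finset.sum_range_succ, add_assoc, hμ, lintegral_state_succ _ x n hw,
        lintegral_ofMap f hf x n hc, lintegral_ofMap f hf x n hQ,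
        ← lintegral_add_left (by fun_prop)]
      gcongr with ω
      exact h _
  rw [perf_eq_tsum _ x hc]
  exact ENNReal.tsum_le_of_sum_range_le fun n => le_self_add.trans (key n)

lemma valueIter_le_perf {c : Y × B → ℝ≥0∞} (hc : Measurable c)
    (hv : ∀ n, Measurable (valueIter Q c n)) (n : ℕ) (π : Strategy Y B) (x : Y) :
    valueIter Q c n x ≤ perf Q x π c := by
  set μ := strategicMeasure Q π x with hμ
  have key : ∀ n m, ∫⁻ ω, valueIter Q c n (ω m).1 ∂μ ≤ ∑' i, ∫⁻ ω, c (ω (i + m)) ∂μ := by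
    intro n
    induction n with
    | zero => intro m; simp [valueIter]
    | succ n ih =>
      intro m
      rw [tsum_eq_zero_add' ENNReal.summable, zero_add]
      calc ∫⁻ ω, valueIter Q c (n + 1) (ω m).1 ∂μ
          ≤ ∫⁻ ω, c (ω m) + ∫⁻ y, valueIter Q c n y ∂(Q (ω m)) ∂μ :=
            lintegral_mono fun ω => iInf_le _ (ω m).2
        _ = ∫⁻ ω, c (ω m) ∂μ + ∫⁻ ω, valueIter Q c n (ω (m + 1)).1 ∂μ := by
            rw [lintegral_add_left (by fun_prop), hμ,
              lintegral_state_succ π x m (hv n)]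
        _ ≤ _ := by
            gcongr
            refine (ih (m + 1)).trans (le_of_eq (tsum_congr fun i => ?_))
            rw [add_assoc, add_comm 1 m]
  rw [perf_eq_tsum π x hc]
  simpa [hμ, lintegral_state_zero π x (hv n)] using key n 0

end Generic

/-! ### Semicontinuity and measurability -/

instance opensMeasurableSpace_sum {α β : Type*} [TopologicalSpace α] [TopologicalSpace β]
    [MeasurableSpace α] [MeasurableSpace β] [OpensMeasurableSpace α] [OpensMeasurableSpace β] :
    OpensMeasurableSpace (α ⊕ β) := by
  constructor
  refine MeasurableSpace.generateFrom_le fun s hs => ?_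
  rw [measurableSet_sum_iff]
  exact ⟨(hs.preimage continuous_inl).measurableSet, (hs.preimage continuous_inr).measurableSet⟩

/-- Minimizing a lower semicontinuous function over a compact factor preserves lower
semicontinuity. -/
lemma lowerSemicontinuous_iInf_of_compactSpace {Y B : Type*} [TopologicalSpace Y]
    [TopologicalSpace B] [CompactSpace B] {f : Y × B → ℝ≥0∞} (hf : LowerSemicontinuous f) :
    LowerSemicontinuous fun y => ⨅ b, f (y, b) := by
  intro y₀ r hr
  obtain ⟨s, hrs, hs⟩ := exists_between hr
  have hclosed : IsClosed (Prod.fst '' (f ⁻¹' Set.Iic s)) :=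
    isClosedMap_fst_of_compactSpace _ (hf.isClosed_preimage s)
  have hy₀ : y₀ ∈ (Prod.fst '' (f ⁻¹' Set.Iic s))ᶜ := by
    rintro ⟨⟨y, b⟩, hz, rfl⟩
    exact absurd (lt_of_lt_of_le hs (iInf_le _ b)) (not_lt.2 hz)
  filter_upwards [hclosed.isOpen_compl.mem_nhds hy₀] with y hy
  refine lt_of_lt_of_le hrs (le_iInf fun b => ?_)
  by_contra hb
  exact hy ⟨(y, b), (not_le.1 hb).le, rfl⟩

/-! ### The Bellman function of the impulse control model -/

namespace Model

section ValueFunction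

variable {X A : Type*} [MetricSpace X] [MeasurableSpace X] [MeasurableSpace A] {J : ℕ}

/-- The state `l(φ(x, θ), a)` after the impulse when the action `b = (θ, a)` is used at `x`. For
`θ = ∞` this is a junk value, which always comes with the weight `disc ∞ = 0`. -/
def jump (M : Model X A J) (x : X) (b : Act A) : X :=
  M.l (M.φ (x, b.1.toNNReal), b.2)

lemma disc_ne_top (M : Model X A J) (θ : ℝ≥0∞) : disc M.α θ ≠ ∞ :=
  ((disc_le_one M.α_pos θ).trans_lt ENNReal.one_lt_top).ne

lemma Q_inl (M : Model X A J) (x : X) (b : Act A) :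
    M.Q (Sum.inl x, b) = disc M.α b.1 • Measure.dirac (Sum.inl (M.jump x b)) +
      (1 - disc M.α b.1) • Measure.dirac (Sum.inr ()) := by
  change M.Qfun (Sum.inl x, b) = _
  obtain ⟨θ, a⟩ := b
  by_cases h : θ = ∞
  · simp [Qfun, h, disc]
  · simp [Qfun, h, jump]

lemma Q_inr (M : Model X A J) (u : Unit) (b : Act A) :
    M.Q (Sum.inr u, b) = Measure.dirac (Sum.inr ()) := rfl

/-- The limit of value iteration for the cost `c`; it is the Bellman function, see
`value_eq_bellmanFun`. -/
noncomputable def bellmanFun (M : Model X A J) (c : State X × Act A → ℝ≥0∞) (y : State X) :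
    ℝ≥0∞ :=
  ⨆ n, valueIter M.Q c n y

lemma bellmanFun_le (M : Model X A J) (c : State X × Act A → ℝ≥0∞) (y : State X) (b : Act A) :
    M.bellmanFun c y ≤ c (y, b) + ∫⁻ y', M.bellmanFun c y' ∂(M.Q (y, b)) := by
  refine iSup_le fun n => (valueIter_mono M.Q c n.le_succ y).trans ((iInf_le _ b).trans ?_)
  gcongr with y'
  exact le_iSup (fun n => valueIter M.Q c n y') n

variable [SecondCountableTopology X] [BorelSpace X]

lemma lintegral_Q_inl (M : Model X A J) {w : State X → ℝ≥0∞} (hw : w (Sum.inr ()) = 0) (x : X)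
    (b : Act A) :
    ∫⁻ y, w y ∂(M.Q (Sum.inl x, b)) = disc M.α b.1 * w (Sum.inl (M.jump x b)) := by
  simp [Q_inl, hw]

lemma lintegral_Q_inr (M : Model X A J) {w : State X → ℝ≥0∞} (hw : w (Sum.inr ()) = 0) (u : Unit)
    (b : Act A) :
    ∫⁻ y, w y ∂(M.Q (Sum.inr u, b)) = 0 := by
  simp [Q_inr, hw]

lemma valueIter_inr [Nonempty A] (M : Model X A J) {c : State X × Act A → ℝ≥0∞}
    (hΔ : ∀ u b, c (Sum.inr u, b) = 0) (n : ℕ) (u : Unit) :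
    valueIter M.Q c n (Sum.inr u) = 0 := by
  induction n generalizing u with
  | zero => rfl
  | succ n ih =>
    rw [valueIter]
    simp [hΔ, lintegral_Q_inr M (ih ())]

lemma bellmanFun_inr [Nonempty A] (M : Model X A J) {c : State X × Act A → ℝ≥0∞}
    (hΔ : ∀ u b, c (Sum.inr u, b) = 0) (u : Unit) : M.bellmanFun c (Sum.inr u) = 0 := by
  simp [bellmanFun, valueIter_inr M hΔ]

/-- A bounded subsolution of the Bellman equation lies below the total cost of every strategy,
if every impulse costs at least `δ > 0`: under a strategy of finite cost the expected discounted
impulse costs are summable, so the probability of not yet being absorbed tends to zero. -/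
lemma le_perf_of_sub (M : Model X A J) {c : State X × Act A → ℝ≥0∞} (hc : Measurable c)
    {δ : ℝ≥0∞} (hδ : δ ≠ 0) (hδ_top : δ ≠ ∞)
    (hcδ : ∀ x b, disc M.α b.1 * δ ≤ c (Sum.inl x, b))
    {w : State X → ℝ≥0∞} (hw : Measurable w) (hwΔ : w (Sum.inr ()) = 0)
    {K : ℝ≥0∞} (hK : K ≠ ∞) (hwK : ∀ y, w y ≤ K)
    (h : ∀ y b, w y ≤ c (y, b) + ∫⁻ y', w y' ∂(M.Q (y, b))) (π : Strategy (State X) (Act A))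
    (x : State X) : w x ≤ perf M.Q x π c := by
  by_cases hp : perf M.Q x π c = ∞
  · simp [hp]
  have htsum := perf_eq_tsum (Q := M.Q) π x hc
  rw [htsum] at hp ⊢
  set e : ℕ → ℝ≥0∞ := fun i => ∫⁻ ω, c (ω i) ∂(strategicMeasure M.Q π x) with he
  have hstep : ∀ z, ∫⁻ y', w y' ∂(M.Q z) ≤ K / δ * c z := by
    rintro ⟨y | y, b⟩
    · rw [lintegral_Q_inl M hwΔ]
      calc disc M.α b.1 * w _ ≤ disc M.α b.1 * K := by gcongr; exact hwK _
        _ = K / δ * (disc M.α b.1 * δ) := by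
            rw [mul_left_comm, ENNReal.div_mul_cancel hδ hδ_top]
        _ ≤ _ := by gcongr; exact hcδ y b
    · simp [lintegral_Q_inr M hwΔ]
  have hbound : ∀ n, w x ≤ ∑' i, e i + K / δ * e n := by
    intro n
    refine (le_sum_add_lintegral (Q := M.Q) π x hc hw h (n + 1)).trans ?_
    gcongr
    · exact ENNReal.sum_le_tsum _
    · rw [lintegral_state_succ π x n hw, he, ← lintegral_const_mul _ (by fun_prop)]
      exact lintegral_mono fun ω => hstep _
  have hlim : Tendsto e atTop (𝓝 0) := by
    rw [← Nat.cofinite_eq_atTop]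
    exact ENNReal.tendsto_cofinite_zero_of_tsum_ne_top hp
  have hlim' : Tendsto (fun n => ∑' i, e i + K / δ * e n) atTop
      (𝓝 (∑' i, e i + K / δ * 0)) :=
    tendsto_const_nhds.add (ENNReal.Tendsto.const_mul hlim
      (Or.inr (ENNReal.div_ne_top hK hδ)))
  rw [mul_zero, add_zero] at hlim'
  exact ge_of_tendsto' hlim' hbound

variable [MetricSpace A]

/-- Weak continuity of the transition law passes to nonnegative lower semicontinuous integrands
vanishing at the cemetery: near a given state-action pair such an integrand is bounded below by a
multiple of a bump function around the state after the jump. -/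
lemma lowerSemicontinuous_lintegral_Q (M : Model X A J)
    (hQ : ∀ u : State X →ᵇ ℝ, Continuous fun z : State X × Act A => ∫ y, u y ∂(M.Q z))
    {w : State X → ℝ≥0∞} (hlsc : LowerSemicontinuous w) (hw : w (Sum.inr ()) = 0) :
    LowerSemicontinuous fun z => ∫⁻ y, w y ∂(M.Q z) := by
  rintro ⟨x | u, b⟩ r hr
  swap
  · simp [lintegral_Q_inr M hw] at hr
  dsimp only at hr
  rw [lintegral_Q_inl M hw] at hr
  obtain ⟨s, hs, hrs⟩ : ∃ s < w (Sum.inl (M.jump x b)), r < disc M.α b.1 * s := by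
    have hd : disc M.α b.1 ≠ 0 := by
      rintro h
      simp [h] at hr
    by_contra! H
    refine absurd hr (not_lt.2 ?_)
    rw [mul_comm, ← ENNReal.le_div_iff_mul_le (Or.inl hd) (Or.inl (M.disc_ne_top _))]
    refine le_of_forall_lt fun t ht => ?_
    obtain ⟨t', htt', ht'⟩ := exists_between ht
    refine lt_of_lt_of_le htt' ?_
    rw [ENNReal.le_div_iff_mul_le (Or.inl hd) (Or.inl (M.disc_ne_top _)), mul_comm]
    exact H t' ht'
  have hopen : IsOpen {x' : X | s < w (Sum.inl x')} :=
    (hlsc.isOpen_preimage s).preimage continuous_inl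
  obtain ⟨ε, hε, hball⟩ := Metric.isOpen_iff.1 hopen _ hs
  -- `v` is a bump function at the state after the jump, supported where `s < w`.
  let v : X → ℝ := fun x' => max 0 (1 - dist x' (M.jump x b) / ε)
  have hv0 : ∀ x', 0 ≤ v x' := fun x' => le_max_left _ _
  have hv1 : ∀ x', v x' ≤ 1 := fun x' => max_le zero_le_one (by
    have : 0 ≤ dist x' (M.jump x b) / ε := by positivity
    linarith)
  have hvc : Continuous v := by fun_prop
  have hu0 : ∀ y, 0 ≤ Sum.elim v (fun _ : Unit => (0 : ℝ)) y := by
    rintro (y | y)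
    · exact hv0 y
    · exact le_rfl
  let u : State X →ᵇ ℝ := BoundedContinuousFunction.ofNormedAddCommGroup
    (Sum.elim v fun _ => 0) (by fun_prop) 1 (by
      rintro (y | y)
      · simpa [abs_of_nonneg (hv0 y)] using hv1 y
      · simp)
  have hle : ∀ y, s * ENNReal.ofReal (u y) ≤ w y := by
    rintro (y | y)
    · by_cases hy : dist y (M.jump x b) < ε
      · calc s * ENNReal.ofReal (v y) ≤ s * 1 := by
              gcongr
              exact ENNReal.ofReal_le_one.2 (hv1 y)
          _ ≤ w (Sum.inl y) := by
              rw [mul_one]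
              exact (hball hy).le
      · have : v y = 0 := max_eq_left (by
          have := (one_le_div hε).2 (not_lt.1 hy)
          linarith)
        change s * ENNReal.ofReal (v y) ≤ _
        simp [this]
    · change s * ENNReal.ofReal 0 ≤ _
      simp
  have hint : ∀ z, ENNReal.ofReal (∫ y, u y ∂(M.Q z)) = ∫⁻ y, ENNReal.ofReal (u y) ∂(M.Q z) :=
    fun z => ofReal_integral_eq_lintegral_ofReal (u.integrable _) (ae_of_all _ hu0)
  have hs_top : s ≠ ∞ := hs.ne_top
  have hcont : Continuous fun z => s * ENNReal.ofReal (∫ y, u y ∂(M.Q z)) :=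
    (ENNReal.continuous_const_mul hs_top).comp (ENNReal.continuous_ofReal.comp (hQ u))
  have h0 : r < s * ENNReal.ofReal (∫ y, u y ∂(M.Q (Sum.inl x, b))) := by
    rw [hint, lintegral_Q_inl M (w := fun y => ENNReal.ofReal (u y)) (by simp [u])]
    have : u (Sum.inl (M.jump x b)) = 1 := by simp [u, v]
    rwa [this, ENNReal.ofReal_one, mul_one, mul_comm]
  filter_upwards [hcont.continuousAt.eventually (lt_mem_nhds h0)] with z hz
  refine hz.trans_le ?_
  rw [hint, ← lintegral_const_mul' _ _ hs_top]
  exact lintegral_mono hle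

lemma lowerSemicontinuous_valueIter [Nonempty A] [CompactSpace (Act A)] (M : Model X A J)
    (hQ : ∀ u : State X →ᵇ ℝ, Continuous fun z : State X × Act A => ∫ y, u y ∂(M.Q z))
    {c : State X × Act A → ℝ≥0∞} (hΔ : ∀ u b, c (Sum.inr u, b) = 0)
    (hc : LowerSemicontinuous c) (n : ℕ) : LowerSemicontinuous (valueIter M.Q c n) := by
  induction n with
  | zero => exact lowerSemicontinuous_const
  | succ n ih =>
    exact lowerSemicontinuous_iInf_of_compactSpace
      (hc.add (lowerSemicontinuous_lintegral_Q M hQ ih (valueIter_inr M hΔ n ())))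

lemma lowerSemicontinuous_bellmanFun [Nonempty A] [CompactSpace (Act A)] (M : Model X A J)
    (hQ : ∀ u : State X →ᵇ ℝ, Continuous fun z : State X × Act A => ∫ y, u y ∂(M.Q z))
    {c : State X × Act A → ℝ≥0∞} (hΔ : ∀ u b, c (Sum.inr u, b) = 0)
    (hc : LowerSemicontinuous c) : LowerSemicontinuous (M.bellmanFun c) :=
  lowerSemicontinuous_iSup fun n => lowerSemicontinuous_valueIter M hQ hΔ hc n

/-- An optimal action exists: the actions whose `n`-step cost is at most the limit of value
iteration form a decreasing sequence of nonempty compact sets. -/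
lemma exists_le_bellmanFun [Nonempty A] [CompactSpace (Act A)] (M : Model X A J)
    (hQ : ∀ u : State X →ᵇ ℝ, Continuous fun z : State X × Act A => ∫ y, u y ∂(M.Q z))
    {c : State X × Act A → ℝ≥0∞} (hΔ : ∀ u b, c (Sum.inr u, b) = 0)
    (hc : LowerSemicontinuous c) (y : State X) :
    ∃ b, c (y, b) + ∫⁻ y', M.bellmanFun c y' ∂(M.Q (y, b)) ≤ M.bellmanFun c y := by
  let h : ℕ → Act A → ℝ≥0∞ := fun n b => c (y, b) + ∫⁻ y', valueIter M.Q c n y' ∂(M.Q (y, b))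
  have hlsc : ∀ n, LowerSemicontinuous (h n) := fun n =>
    (hc.add (lowerSemicontinuous_lintegral_Q M hQ (lowerSemicontinuous_valueIter M hQ hΔ hc n)
      (valueIter_inr M hΔ n ()))).comp (Continuous.prodMk_right y)
  have hmono : Monotone h := fun m n hmn b => by
    dsimp only [h]
    gcongr with y'
    exact valueIter_mono M.Q c hmn y'
  have hclosed : ∀ n, IsClosed (h n ⁻¹' Set.Iic (M.bellmanFun c y)) :=
    fun n => (hlsc n).isClosed_preimage _
  obtain ⟨b, hb⟩ := IsCompact.nonempty_iInter_of_sequence_nonempty_isCompact_isClosed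
    (fun n => h n ⁻¹' Set.Iic (M.bellmanFun c y))
    (fun n b hb => (hmono n.le_succ b).trans hb)
    (fun n => by
      obtain ⟨b, -, hb⟩ := ((hlsc n).lowerSemicontinuousOn Set.univ).exists_isMinOn
        Set.univ_nonempty isCompact_univ
      refine ⟨b, ?_⟩
      change h n b ≤ _
      refine le_trans (le_iInf fun b' => hb (Set.mem_univ b')) ?_
      exact le_iSup (fun n => valueIter M.Q c n y) (n + 1))
    (hclosed 0).isCompact hclosed
  refine ⟨b, ?_⟩
  have hmeas : ∀ n, Measurable (valueIter M.Q c n) := fun n =>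
    (lowerSemicontinuous_valueIter M hQ hΔ hc n).measurable
  simp only [bellmanFun] at hb ⊢
  rw [lintegral_iSup hmeas (valueIter_mono M.Q c), ENNReal.add_iSup]
  exact iSup_le fun n => Set.mem_iInter.1 hb n

variable [SecondCountableTopology A] [BorelSpace A]

/-- The Bellman function is the limit of value iteration. For the upper bound no measurable
selection is needed: from a given initial state, a deterministic choice of optimal actions visits
only countably many states, and it may be altered elsewhere. -/
theorem value_eq_bellmanFun [Nonempty A] [CompactSpace (Act A)] (M : Model X A J)
    (hQ : ∀ u : State X →ᵇ ℝ, Continuous fun z : State X × Act A => ∫ y, u y ∂(M.Q z))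
    {c : State X × Act A → ℝ≥0∞} (hΔ : ∀ u b, c (Sum.inr u, b) = 0)
    (hc : LowerSemicontinuous c) (x : State X) : value M.Q x c = M.bellmanFun c x := by
  classical
  have hmeas : ∀ n, Measurable (valueIter M.Q c n) := fun n =>
    (lowerSemicontinuous_valueIter M hQ hΔ hc n).measurable
  refine le_antisymm ?_ (iSup_le fun n => le_iInf fun π =>
    valueIter_le_perf hc.measurable hmeas n π x)
  choose F₀ hF₀ using exists_le_bellmanFun M hQ hΔ hc
  let next : State X → State X :=
    Sum.elim (fun x => Sum.inl (M.jump x (F₀ (Sum.inl x)))) Sum.inr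
  let O : Set (State X) := insert (Sum.inr ()) (Set.range fun n => next^[n] x)
  have hO : O.Countable := (Set.countable_range _).insert _
  have hnext : ∀ y ∈ O, next y ∈ O := by
    rintro y (rfl | ⟨n, rfl⟩)
    · exact Set.mem_insert _ _
    · exact Set.mem_insert_of_mem _ ⟨n + 1, Function.iterate_succ_apply' _ _ _⟩
  have hxO : x ∈ O := Set.mem_insert_of_mem _ ⟨0, rfl⟩
  let F : State X → Act A := fun y => if y ∈ O then F₀ y else Classical.arbitrary _
  have hF : Measurable F := by
    refine Measurable.measurable_of_countable_ne
      (measurable_const (a := (Classical.arbitrary (Act A)))) (hO.mono fun y hy => ?_)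
    by_contra h
    exact hy (by simp [F, h])
  -- The value `∞` outside `O` makes the one-step inequality trivial where `F` is arbitrary.
  let w : State X → ℝ≥0∞ := fun y => if y ∈ O then M.bellmanFun c y else ∞
  have hw : Measurable w := by
    refine Measurable.ite hO.measurableSet ?_ measurable_const
    exact (lowerSemicontinuous_bellmanFun M hQ hΔ hc).measurable
  have hwO : ∀ y ∈ O, w y = M.bellmanFun c y := fun y hy => if_pos hy
  have hwΔ : w (Sum.inr ()) = 0 := by
    rw [hwO _ (Set.mem_insert _ _), bellmanFun_inr M hΔ]
  have hstep : ∀ y, c (y, F y) + ∫⁻ y', w y' ∂(M.Q (y, F y)) ≤ w y := by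
    intro y
    by_cases hy : y ∈ O
    · rw [hwO y hy, show F y = F₀ y from if_pos hy]
      refine le_trans (le_of_eq ?_) (hF₀ y)
      congr 1
      rcases y with y | y
      · rw [lintegral_Q_inl M hwΔ, lintegral_Q_inl M (bellmanFun_inr M hΔ ())]
        exact congrArg _ (hwO _ (hnext _ hy))
      · rw [lintegral_Q_inr M hwΔ, lintegral_Q_inr M (bellmanFun_inr M hΔ ())]
    · simp [w, hy]
  calc value M.Q x c ≤ perf M.Q x (Strategy.ofMap F hF) c := iInf_le _ _
    _ ≤ w x := perf_ofMap_le F hF hc.measurable hw hstep x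
    _ = M.bellmanFun c x := hwO x hxO

end ValueFunction

/-! ### Costs of the impulse control model -/

section Costs

variable {X A : Type*} [TopologicalSpace X] [MeasurableSpace X] [MeasurableSpace A] {J : ℕ}

lemma sumCost_eq_lagCost (M : Model X A J) : M.sumCost = M.lagCost 1 := by
  funext z
  simp [sumCost, lagCost, Fin.sum_univ_succ]

lemma cost_le_sumCost (M : Model X A J) (j : Fin (J + 1)) (z : State X × Act A) :
    M.cost j z ≤ M.sumCost z :=
  Finset.single_le_sum (f := fun j => M.cost j z) (fun _ _ => zero_le) (Finset.mem_univ j)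

lemma lagCost_inr (M : Model X A J) (g : Fin J → ℝ≥0) (u : Unit) (b : Act A) :
    M.lagCost g (Sum.inr u, b) = 0 := by
  simp [lagCost, cost]

lemma lagCost_eq_zero (M : Model X A J) (g : Fin J → ℝ≥0) {z : State X × Act A}
    (h : M.sumCost z = 0) : M.lagCost g z = 0 := by
  have hj : ∀ j, M.cost j z = 0 := fun j => le_antisymm ((M.cost_le_sumCost j z).trans h.le) zero_le
  simp [lagCost, hj]

/-- The lower bound on the impulse costs may be taken finite. -/
lemma CostCondition.exists_impulse_lower_bound {M : Model X A J} (hcost : M.CostCondition) :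
    ∃ δ : ℝ≥0, 0 < δ ∧ ∀ x a, (δ : ℝ≥0∞) ≤ M.CI 0 (x, a) := by
  obtain ⟨δ, hδ, hCI⟩ := hcost.impulse_pos
  obtain ⟨ε, hε, hεδ⟩ := ENNReal.lt_iff_exists_nnreal_btwn.1 hδ
  exact ⟨ε, ENNReal.coe_pos.1 hε, fun x a => hεδ.le.trans (hCI x a)⟩

lemma disc_mul_le_lagCost (M : Model X A J) (g : Fin J → ℝ≥0) {δ : ℝ≥0}
    (hδ : ∀ x a, δ ≤ M.CI 0 (x, a)) (x : X) (b : Act A) :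
    disc M.α b.1 * δ ≤ M.lagCost g (Sum.inl x, b) := by
  obtain ⟨θ, a⟩ := b
  calc disc M.α θ * δ ≤ disc M.α θ * M.CI 0 (M.φ (x, θ.toNNReal), a) := by
        gcongr
        exact hδ _ _
    _ ≤ M.cost 0 (Sum.inl x, (θ, a)) := le_add_self
    _ ≤ _ := le_self_add

/-- The cost of never applying an impulse is bounded, since the discounted running cost is. -/
lemma exists_lagCost_top_le (M : Model X A J) (hcost : M.CostCondition) (g : Fin J → ℝ≥0) :
    ∃ K : ℝ≥0, ∀ x a, M.lagCost g (Sum.inl x, (∞, a)) ≤ K := by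
  set C := ⨆ j, ⨆ x, M.Cg j x
  have hC : C ≠ ∞ := (lt_of_le_of_lt le_self_add hcost.bounded).ne
  set I := ∫⁻ t in Set.Ioi (-1 : ℝ), ENNReal.ofReal (Real.exp (-(M.α * t)))
  have hI : I ≠ ∞ := by
    have := (exp_neg_integrableOn_Ioi (-1) M.α_pos).lintegral_lt_top
    simp only [neg_mul] at this
    exact this.ne
  have hj : ∀ j x a, M.cost j (Sum.inl x, (∞, a)) ≤ I * C := by
    intro j x a
    have h0 : disc M.α ∞ = 0 := by simp [disc]
    simp only [cost, h0, zero_mul, add_zero]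
    -- `Ioi (-1)` is an open half line containing the domain of integration `[0, ∞)`.
    refine (lintegral_mono_set (t := Set.Ioi (-1)) fun t ht => ?_).trans ?_
    · exact lt_of_lt_of_le (by norm_num) ht.1
    rw [← lintegral_mul_const' _ _ hC]
    refine lintegral_mono fun t => ?_
    gcongr
    exact le_iSup_of_le j (le_iSup_of_le _ le_rfl)
  have hfin : I * C + ∑ j : Fin J, (g j : ℝ≥0∞) * (I * C) ≠ ∞ := by
    have h := ENNReal.mul_ne_top hI hC
    exact ENNReal.add_ne_top.2 ⟨h, ENNReal.sum_ne_top.2 fun j _ =>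
      ENNReal.mul_ne_top ENNReal.coe_ne_top h⟩
  refine ⟨(I * C + ∑ j : Fin J, (g j : ℝ≥0∞) * (I * C)).toNNReal, fun x a => ?_⟩
  rw [ENNReal.coe_toNNReal hfin, lagCost]
  gcongr <;> exact hj _ _ _

lemma perf_lagCost (M : Model X A J) (hc : ∀ j, Measurable (M.cost j)) (g : Fin J → ℝ≥0)
    (π : Strategy (State X) (Act A)) (x : State X) :
    perf M.Q x π (M.lagCost g) =
      perf M.Q x π (M.cost 0) + ∑ j : Fin J, (g j : ℝ≥0∞) * perf M.Q x π (M.cost j.succ) := by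
  have hm : ∀ j : Fin J, ∀ i : ℕ, Measurable fun ω : ℕ → State X × Act A =>
      M.cost j.succ (ω i) := fun j i => (hc _).comp (measurable_pi_apply i)
  have h0 : Measurable fun ω : ℕ → State X × Act A => ∑' i, M.cost 0 (ω i) :=
    Measurable.tsum fun i => (hc 0).comp (measurable_pi_apply i)
  simp only [perf, lagCost]
  rw [← lintegral_congr fun ω => (ENNReal.tsum_add).symm, lintegral_add_left h0]
  congr 1
  simp_rw [Summable.tsum_finsetSum fun _ _ => ENNReal.summable, ENNReal.tsum_mul_left]
  rw [lintegral_finsetSum _ fun j _ => (Measurable.tsum (hm j)).const_mul _]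
  exact Finset.sum_congr rfl fun j _ => lintegral_const_mul _ (Measurable.tsum (hm j))

lemma disc_eq_zero_iff (α : ℝ) (θ : ℝ≥0∞) : disc α θ = 0 ↔ θ = ∞ := by
  unfold disc
  split_ifs with h
  · simp [h]
  · simp [h, Real.exp_pos]

/-- A step with total cost zero consists of never applying an impulse again. -/
lemma eq_top_of_sumCost_eq_zero (M : Model X A J) (hcost : M.CostCondition) {x : X} {b : Act A}
    (h : M.sumCost (Sum.inl x, b) = 0) : b.1 = ∞ := by
  obtain ⟨δ, hδ, hCI⟩ := hcost.exists_impulse_lower_bound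
  have := M.disc_mul_le_lagCost 1 hCI x b
  rw [← sumCost_eq_lagCost, h, nonpos_iff_eq_zero, mul_eq_zero] at this
  rcases this with h | h
  · exact (disc_eq_zero_iff _ _).1 h
  · exact absurd (ENNReal.coe_eq_zero.1 h) hδ.ne'

/-- Outside `V`, an optimal stationary strategy for the total cost incurs no cost. -/
lemma sumCost_eq_zero_of_perf_eq (M : Model X A J) (hc : Measurable M.sumCost) {f : State X → Act A}
    (hf : Measurable f) {y : State X} (hy : y ∉ M.V)
    (h : perf M.Q y (Strategy.ofMap f hf) M.sumCost = value M.Q y M.sumCost) :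
    M.sumCost (y, f y) = 0 := by
  have h0 : value M.Q y M.sumCost = 0 := by simpa [V] using hy
  rw [h0, perf_eq_tsum _ _ hc, ENNReal.tsum_eq_zero] at h
  have := h 0
  rwa [lintegral_ofMap f hf y 0 hc,
    lintegral_state_zero _ y (w := fun y => M.sumCost (y, f y)) (by fun_prop)] at this

end Costs

/-! ### Extension by zero from `V` -/

section Extension

variable {X A : Type*} [TopologicalSpace X] [MeasurableSpace X] [MeasurableSpace A] {J : ℕ}

open scoped Classical in
/-- Extension by zero of a function on `V`. -/
noncomputable def extend (M : Model X A J) (W : M.V → ℝ) (y : State X) : ℝ :=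
  if h : y ∈ M.V then W ⟨y, h⟩ else 0

lemma extend_coe {M : Model X A J} (W : M.V → ℝ) (x : M.V) : M.extend W x = W x := by
  simp [extend]

lemma extend_of_notMem {M : Model X A J} (W : M.V → ℝ) {y : State X} (hy : y ∉ M.V) :
    M.extend W y = 0 := by
  simp [extend, hy]

end Extension

/-! ### The Bellman function of a weighted cost, and its zero set -/

variable {X A : Type*} [MetricSpace X] [MeasurableSpace X] [MetricSpace A] [MeasurableSpace A]
  {J : ℕ} {M : Model X A J}

lemma lowerSemicontinuous_lagCost (hsc : IsSemicontinuous M.Q M.cost) (g : Fin J → ℝ≥0) :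
    LowerSemicontinuous (M.lagCost g) := by
  refine (hsc.lsc_cost 0).add (lowerSemicontinuous_sum fun j _ => ?_)
  exact (ENNReal.continuous_const_mul ENNReal.coe_ne_top).comp_lowerSemicontinuous
    (hsc.lsc_cost j.succ) (fun _ _ h => mul_le_mul_right h _)

variable [SecondCountableTopology X] [BorelSpace X] [SecondCountableTopology A] [BorelSpace A]
  [Nonempty A]

lemma value_lagCost_eq (hsc : IsSemicontinuous M.Q M.cost) (g : Fin J → ℝ≥0) (y : State X) :
    value M.Q y (M.lagCost g) = M.bellmanFun (M.lagCost g) y :=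
  have := hsc.compact_action
  value_eq_bellmanFun M hsc.weakly_continuous (M.lagCost_inr g)
    (lowerSemicontinuous_lagCost hsc g) y

lemma lowerSemicontinuous_value (hsc : IsSemicontinuous M.Q M.cost) (g : Fin J → ℝ≥0) :
    LowerSemicontinuous fun y => value M.Q y (M.lagCost g) := by
  have := hsc.compact_action
  simp_rw [value_lagCost_eq hsc]
  exact lowerSemicontinuous_bellmanFun M hsc.weakly_continuous (M.lagCost_inr g)
    (lowerSemicontinuous_lagCost hsc g)

lemma value_inr (hsc : IsSemicontinuous M.Q M.cost) (g : Fin J → ℝ≥0) (u : Unit) :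
    value M.Q (Sum.inr u) (M.lagCost g) = 0 := by
  rw [value_lagCost_eq hsc, bellmanFun_inr M (M.lagCost_inr g)]

lemma value_le_step (hsc : IsSemicontinuous M.Q M.cost) (g : Fin J → ℝ≥0) (y : State X)
    (b : Act A) : value M.Q y (M.lagCost g) ≤
      M.lagCost g (y, b) + ∫⁻ y', value M.Q y' (M.lagCost g) ∂(M.Q (y, b)) := by
  simp_rw [value_lagCost_eq hsc]
  exact bellmanFun_le M _ y b

lemma exists_step_le_value (hsc : IsSemicontinuous M.Q M.cost) (g : Fin J → ℝ≥0) (y : State X) :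
    ∃ b, M.lagCost g (y, b) + ∫⁻ y', value M.Q y' (M.lagCost g) ∂(M.Q (y, b)) ≤
      value M.Q y (M.lagCost g) := by
  have := hsc.compact_action
  simp_rw [value_lagCost_eq hsc]
  exact exists_le_bellmanFun M hsc.weakly_continuous (M.lagCost_inr g)
    (lowerSemicontinuous_lagCost hsc g) y

lemma measurableSet_V (hsc : IsSemicontinuous M.Q M.cost) : MeasurableSet M.V := by
  unfold V
  rw [sumCost_eq_lagCost]
  exact measurableSet_lt measurable_const (lowerSemicontinuous_value hsc 1).measurable

lemma inr_notMem_V (hsc : IsSemicontinuous M.Q M.cost) (u : Unit) : Sum.inr u ∉ M.V := by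
  simp [V, sumCost_eq_lagCost, value_inr hsc]

/-- Outside `V` no cost at all is incurred when no impulse is ever applied. -/
lemma exists_top_lagCost_eq_zero (hsc : IsSemicontinuous M.Q M.cost) (hcost : M.CostCondition)
    (g : Fin J → ℝ≥0) {x : X} (hx : Sum.inl x ∉ M.V) :
    ∃ a, M.lagCost g (Sum.inl x, (∞, a)) = 0 := by
  have h0 : value M.Q (Sum.inl x) (M.lagCost 1) = 0 := by
    rw [← sumCost_eq_lagCost]
    simpa [V] using hx
  obtain ⟨⟨θ, a⟩, hb⟩ := exists_step_le_value hsc 1 (Sum.inl x)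
  rw [h0, nonpos_iff_eq_zero, add_eq_zero, ← sumCost_eq_lagCost] at hb
  have hθ : θ = ∞ := M.eq_top_of_sumCost_eq_zero hcost hb.1
  subst hθ
  exact ⟨a, M.lagCost_eq_zero g hb.1⟩

lemma exists_step_eq_zero_of_notMem_V (hsc : IsSemicontinuous M.Q M.cost)
    (hcost : M.CostCondition) (g : Fin J → ℝ≥0) {w : State X → ℝ≥0∞} (hw : w (Sum.inr ()) = 0)
    {y : State X} (hy : y ∉ M.V) :
    ∃ b, M.lagCost g (y, b) + ∫⁻ y', w y' ∂(M.Q (y, b)) = 0 := by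
  rcases y with x | u
  · obtain ⟨a, ha⟩ := exists_top_lagCost_eq_zero hsc hcost g hy
    exact ⟨(∞, a), by simp [ha, lintegral_Q_inl M hw, disc]⟩
  · obtain ⟨b⟩ : Nonempty (Act A) := inferInstance
    exact ⟨b, by simp [lagCost_inr, lintegral_Q_inr M hw]⟩

lemma value_eq_zero_of_notMem_V (hsc : IsSemicontinuous M.Q M.cost) (hcost : M.CostCondition)
    (g : Fin J → ℝ≥0) {y : State X} (hy : y ∉ M.V) : value M.Q y (M.lagCost g) = 0 := by
  obtain ⟨b, hb⟩ := exists_step_eq_zero_of_notMem_V hsc hcost g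
    (w := fun y => value M.Q y (M.lagCost g)) (value_inr hsc g ()) hy
  exact le_antisymm ((value_le_step hsc g y b).trans hb.le) zero_le

lemma exists_value_le (hsc : IsSemicontinuous M.Q M.cost) (hcost : M.CostCondition)
    (g : Fin J → ℝ≥0) : ∃ K : ℝ≥0, ∀ y, value M.Q y (M.lagCost g) ≤ K := by
  obtain ⟨K, hK⟩ := M.exists_lagCost_top_le hcost g
  refine ⟨K, ?_⟩
  rintro (x | u)
  · obtain ⟨a⟩ : Nonempty A := inferInstance
    refine (value_le_step hsc g _ (∞, a)).trans ?_
    rw [lintegral_Q_inl M (w := fun y => value M.Q y (M.lagCost g)) (value_inr hsc g ())]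
    simpa [disc] using hK x a
  · simp [value_inr hsc]

/-! ### The Bellman equation on `V` -/

lemma measurable_extend (hsc : IsSemicontinuous M.Q M.cost) {W : M.V → ℝ} (hW : Measurable W) :
    Measurable (M.extend W) := by
  classical
  unfold extend
  exact Measurable.dite (s := M.V) hW measurable_const (measurableSet_V hsc)

lemma integral_comap_Q_inl (hsc : IsSemicontinuous M.Q M.cost) (W : M.V → ℝ) (x : X)
    (b : Act A) :
    ∫ y : M.V, W y ∂((M.Q (Sum.inl x, b)).comap (Subtype.val : M.V → State X)) =
      (disc M.α b.1).toReal * M.extend W (Sum.inl (M.jump x b)) := by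
  simp_rw [← extend_coe W]
  rw [integral_subtype_comap (measurableSet_V hsc) (M.extend W),
    setIntegral_eq_integral_of_forall_compl_eq_zero fun y hy => extend_of_notMem W hy, Q_inl,
    integral_add_measure, integral_smul_measure, integral_smul_measure, integral_dirac,
    integral_dirac, extend_of_notMem W (inr_notMem_V hsc ())]
  · simp
  · exact (integrable_dirac (by simp)).smul_measure (M.disc_ne_top _)
  · exact (integrable_dirac (by simp)).smul_measure (by simp)

/-- For nonnegative functions the Bellman operator can be computed in `ℝ≥0∞`. -/
lemma bellmanTerm_eq (hsc : IsSemicontinuous M.Q M.cost) (g : Fin J → ℝ≥0) {W : M.V → ℝ}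
    {w : State X → ℝ≥0∞} (hW : ∀ y, M.extend W y = (w y).toReal) (hfin : ∀ y, w y ≠ ∞)
    (hw : w (Sum.inr ()) = 0) (x : M.V) (b : Act A) :
    M.bellmanTerm g W (x, b) =
      ((M.lagCost g (x, b) + ∫⁻ y, w y ∂(M.Q (x, b)) : ℝ≥0∞) : EReal) := by
  obtain ⟨x | u, hx⟩ := x
  swap
  · exact absurd hx (inr_notMem_V hsc u)
  rw [bellmanTerm, integral_comap_Q_inl hsc, lintegral_Q_inl M hw, hW, ← ENNReal.toReal_mul,
    EReal.coe_ennreal_toReal (ENNReal.mul_ne_top (M.disc_ne_top _) (hfin _)),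
    EReal.coe_ennreal_add]

lemma extend_value (hsc : IsSemicontinuous M.Q M.cost) (hcost : M.CostCondition)
    (g : Fin J → ℝ≥0) (y : State X) :
    M.extend (fun x => (M.Wstar g x).toReal) y = (value M.Q y (M.lagCost g)).toReal := by
  by_cases hy : y ∈ M.V
  · exact extend_coe _ ⟨y, hy⟩
  · rw [extend_of_notMem _ hy, value_eq_zero_of_notMem_V hsc hcost g hy, ENNReal.toReal_zero]

lemma value_ne_top (hsc : IsSemicontinuous M.Q M.cost) (hcost : M.CostCondition)
    (g : Fin J → ℝ≥0) (y : State X) : value M.Q y (M.lagCost g) ≠ ∞ := by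
  obtain ⟨K, hK⟩ := exists_value_le hsc hcost g
  exact ((hK y).trans_lt ENNReal.coe_lt_top).ne

lemma bellmanTerm_Wstar (hsc : IsSemicontinuous M.Q M.cost) (hcost : M.CostCondition)
    (g : Fin J → ℝ≥0) (x : M.V) (b : Act A) :
    M.bellmanTerm g (fun x => (M.Wstar g x).toReal) (x, b) =
      ((M.lagCost g (x, b) + ∫⁻ y, value M.Q y (M.lagCost g) ∂(M.Q (x, b)) : ℝ≥0∞) : EReal) :=
  bellmanTerm_eq hsc g (extend_value hsc hcost g) (value_ne_top hsc hcost g) (value_inr hsc g ())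
    x b

lemma coe_toReal_Wstar (hsc : IsSemicontinuous M.Q M.cost) (hcost : M.CostCondition)
    (g : Fin J → ℝ≥0) (x : M.V) :
    (((M.Wstar g x).toReal : ℝ) : EReal) = (value M.Q x (M.lagCost g) : EReal) :=
  EReal.coe_ennreal_toReal (value_ne_top hsc hcost g x)

lemma bellmanEq_Wstar (hsc : IsSemicontinuous M.Q M.cost) (hcost : M.CostCondition)
    (g : Fin J → ℝ≥0) : M.BellmanEq g fun x => (M.Wstar g x).toReal := by
  intro x
  simp only [coe_toReal_Wstar hsc hcost, bellmanTerm_Wstar hsc hcost]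
  refine le_antisymm (le_iInf fun b => ?_) ?_
  · exact EReal.coe_ennreal_le_coe_ennreal_iff.2 (value_le_step hsc g x b)
  · obtain ⟨b, hb⟩ := exists_step_le_value hsc g x
    exact iInf_le_of_le b (EReal.coe_ennreal_le_coe_ennreal_iff.2 hb)

lemma isBddMeas_Wstar (hsc : IsSemicontinuous M.Q M.cost) (hcost : M.CostCondition)
    (g : Fin J → ℝ≥0) : M.IsBddMeas fun x => (M.Wstar g x).toReal := by
  refine ⟨((lowerSemicontinuous_value hsc g).measurable.comp measurable_subtype_coe).ennreal_toReal,
    ?_⟩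
  obtain ⟨K, hK⟩ := exists_value_le hsc hcost g
  refine ⟨K, fun x => ?_⟩
  rw [abs_of_nonneg ENNReal.toReal_nonneg]
  exact ENNReal.toReal_le_of_le_ofReal K.2 (by simpa [Wstar] using hK x)

lemma dualFeasible_Wstar (hsc : IsSemicontinuous M.Q M.cost) (hcost : M.CostCondition)
    (g : Fin J → ℝ≥0) : M.DualFeasible g fun x => (M.Wstar g x).toReal := by
  refine ⟨isBddMeas_Wstar hsc hcost g, fun x b => ?_⟩
  rw [EReal.sub_nonneg (Or.inr (EReal.coe_ne_top _)) (Or.inr (EReal.coe_ne_bot _)),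
    bellmanEq_Wstar hsc hcost g x]
  exact iInf_le _ b

lemma lowerSemicontinuous_Wstar (hsc : IsSemicontinuous M.Q M.cost) (hcost : M.CostCondition)
    (g : Fin J → ℝ≥0) : LowerSemicontinuous fun x : M.V => (M.Wstar g x).toReal := by
  intro x r hr
  rcases lt_or_ge r 0 with h | h
  · exact Eventually.of_forall fun y => h.trans_le ENNReal.toReal_nonneg
  have hlsc : LowerSemicontinuous fun x : M.V => M.Wstar g x :=
    (lowerSemicontinuous_value hsc g).comp continuous_subtype_val
  filter_upwards [hlsc x (ENNReal.ofReal r)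
    ((ENNReal.ofReal_lt_iff_lt_toReal h (value_ne_top hsc hcost g x)).2 hr)] with y hy
  exact (ENNReal.ofReal_lt_iff_lt_toReal h (value_ne_top hsc hcost g y)).1 hy

/-! ### Uniqueness of bounded solutions -/

/-- Bounded solutions of the Bellman equation are nonnegative: every step which does not lead to
absorption costs at least `δ`, so that a lower bound `-k` can be improved to `-(k - δ)`. -/
lemma nonneg_of_bellmanEq (hsc : IsSemicontinuous M.Q M.cost) (hcost : M.CostCondition)
    (g : Fin J → ℝ≥0) {W : M.V → ℝ} (hbdd : ∃ K : ℝ, ∀ x, |W x| ≤ K) (hW : M.BellmanEq g W)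
    (x : M.V) : 0 ≤ W x := by
  obtain ⟨δ, hδ, hCI⟩ := hcost.exists_impulse_lower_bound
  obtain ⟨K, hK⟩ := hbdd
  have key : ∀ n : ℕ, ∀ x, -max (K - n * δ) 0 ≤ W x := by
    intro n
    induction n with
    | zero =>
      intro x
      have h1 := neg_abs_le (W x)
      have h2 := hK x
      have h3 := le_max_left (K - (0 : ℕ) * (δ : ℝ)) 0
      simp only [Nat.cast_zero, zero_mul] at h3 ⊢
      linarith
    | succ n ih =>
      intro x
      have hext : ∀ y, -max (K - n * δ) 0 ≤ M.extend W y := by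
        intro y
        by_cases hy : y ∈ M.V
        · exact (ih ⟨y, hy⟩).trans_eq (extend_coe W ⟨y, hy⟩).symm
        · rw [extend_of_notMem W hy]
          exact neg_nonpos.2 (le_max_right _ _)
      rw [← EReal.coe_le_coe_iff, hW x]
      refine le_iInf fun b => ?_
      obtain ⟨x | u, hx⟩ := x
      swap
      · exact absurd hx (inr_notMem_V hsc u)
      rw [bellmanTerm, integral_comap_Q_inl hsc]
      -- The right-hand side is at least `d δ - d k` with `0 ≤ d ≤ 1`, where `-k` bounds `W` below.
      set d := (disc M.α b.1).toReal with hd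
      have hd0 : 0 ≤ d := ENNReal.toReal_nonneg
      have hd1 : d ≤ 1 := ENNReal.toReal_le_of_le_ofReal zero_le_one
        (by simpa using disc_le_one M.α_pos b.1)
      have hlag : ((d * δ : ℝ) : EReal) ≤ (M.lagCost g (Sum.inl x, b) : EReal) := by
        rw [hd, ← ENNReal.coe_toReal δ, ← ENNReal.toReal_mul,
          EReal.coe_ennreal_toReal (ENNReal.mul_ne_top (M.disc_ne_top _) ENNReal.coe_ne_top)]
        exact EReal.coe_ennreal_le_coe_ennreal_iff.2 (M.disc_mul_le_lagCost g hCI x b)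
      refine le_trans ?_ (add_le_add_left hlag _)
      rw [← EReal.coe_add, EReal.coe_le_coe_iff]
      have hE := mul_le_mul_of_nonneg_left (hext (Sum.inl (M.jump x b))) hd0
      push_cast
      have hδ' : (0 : ℝ) < δ := hδ
      rcases le_total (K - n * δ) 0 with h | h
      · rw [max_eq_right h] at hE
        have := le_max_right (K - (n + 1) * (δ : ℝ)) 0
        nlinarith [mul_nonneg hd0 hδ'.le]
      · rw [max_eq_left h] at hE
        rcases le_total (K - (n + 1) * δ) 0 with h' | h'
        · rw [max_eq_right h']
          nlinarith
        · rw [max_eq_left h']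
          nlinarith
  obtain ⟨n, hn⟩ := exists_nat_ge (K / δ)
  have hδ' : (0 : ℝ) < δ := hδ
  have h := key n x
  rwa [max_eq_right (by rw [div_le_iff₀ hδ'] at hn; linarith), neg_zero] at h

/-- The Bellman equation has only one bounded measurable solution: a solution is a subsolution,
hence below the value, and a nonnegative supersolution, hence above value iteration. -/
theorem eq_Wstar_of_bellmanEq (hsc : IsSemicontinuous M.Q M.cost) (hcost : M.CostCondition)
    (g : Fin J → ℝ≥0) {W : M.V → ℝ} (hWm : M.IsBddMeas W) (hW : M.BellmanEq g W) :
    W = fun x => (M.Wstar g x).toReal := by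
  have hnn := nonneg_of_bellmanEq hsc hcost g hWm.2 hW
  obtain ⟨hmeas, K, hK⟩ := hWm
  obtain ⟨δ, hδ, hCI⟩ := hcost.exists_impulse_lower_bound
  let w : State X → ℝ≥0∞ := fun y => ENNReal.ofReal (M.extend W y)
  have hw : Measurable w := (measurable_extend hsc hmeas).ennreal_ofReal
  have hw0 : ∀ y ∉ M.V, w y = 0 := fun y hy => by simp [w, extend_of_notMem W hy]
  have hwΔ : w (Sum.inr ()) = 0 := hw0 _ (inr_notMem_V hsc ())
  have hwV : ∀ x : M.V, (W x : EReal) = (w x : EReal) := fun x => by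
    simp only [w, extend_coe, EReal.coe_ennreal_ofReal, max_eq_left (hnn x)]
  have hext : ∀ y, M.extend W y = (w y).toReal := by
    intro y
    refine (ENNReal.toReal_ofReal ?_).symm
    by_cases hy : y ∈ M.V
    · exact (hnn ⟨y, hy⟩).trans_eq (extend_coe W ⟨y, hy⟩).symm
    · exact (extend_of_notMem W hy).ge
  have hterm := bellmanTerm_eq hsc g hext (fun _ => ENNReal.ofReal_ne_top) hwΔ
  have hsub : ∀ y b, w y ≤ M.lagCost g (y, b) + ∫⁻ y', w y' ∂(M.Q (y, b)) := by
    intro y b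
    by_cases hy : y ∈ M.V
    · rw [← EReal.coe_ennreal_le_coe_ennreal_iff, ← hterm ⟨y, hy⟩ b, ← hwV ⟨y, hy⟩, hW]
      exact iInf_le _ b
    · simp [hw0 y hy]
  have hsuper : ∀ y, ⨅ b, M.lagCost g (y, b) + ∫⁻ y', w y' ∂(M.Q (y, b)) ≤ w y := by
    intro y
    by_cases hy : y ∈ M.V
    · rw [← EReal.coe_ennreal_le_coe_ennreal_iff, ← hwV ⟨y, hy⟩, hW]
      refine le_iInf fun b => ?_
      rw [hterm ⟨y, hy⟩ b]
      exact EReal.coe_ennreal_le_coe_ennreal_iff.2 (iInf_le _ b)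
    · obtain ⟨b, hb⟩ := exists_step_eq_zero_of_notMem_V hsc hcost g hwΔ hy
      exact iInf_le_of_le b (hb.trans_le zero_le)
  have hwK : ∀ y, w y ≤ ENNReal.ofReal K := by
    intro y
    by_cases hy : y ∈ M.V
    · refine ENNReal.ofReal_le_ofReal ?_
      exact (extend_coe W ⟨y, hy⟩).trans_le ((le_abs_self _).trans (hK _))
    · simp [hw0 y hy]
  have heq : ∀ y, w y = value M.Q y (M.lagCost g) := by
    intro y
    refine le_antisymm (le_iInf fun π => ?_) ?_
    · exact le_perf_of_sub M (lowerSemicontinuous_lagCost hsc g).measurable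
        (ENNReal.coe_ne_zero.2 hδ.ne') ENNReal.coe_ne_top (M.disc_mul_le_lagCost g hCI) hw hwΔ
        ENNReal.ofReal_ne_top hwK hsub π y
    · rw [value_lagCost_eq hsc]
      exact iSup_le fun n => valueIter_le_of_super hsuper n y
  funext x
  rw [Wstar, ← heq, ← hext, extend_coe]

/-! ### Optimality of minimizing selectors -/

lemma measurable_glue (hsc : IsSemicontinuous M.Q M.cost) {f : M.V → Act A} (hf : Measurable f)
    {fstar : State X → Act A} (hfstar : Measurable fstar) : Measurable (M.glue f fstar) := by
  classical
  unfold glue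
  convert! Measurable.dite (s := M.V) hf (hfstar.comp measurable_subtype_coe) (measurableSet_V hsc)

/-- Minimizers on `V`, continued by an optimal strategy for the total cost, attain the minimum in
the Bellman equation on the whole state space. -/
lemma glue_step_le_value (hsc : IsSemicontinuous M.Q M.cost) (hcost : M.CostCondition)
    (g : Fin J → ℝ≥0) {f : M.V → Act A} {fstar : State X → Act A} (hfstar : Measurable fstar)
    (hopt : ∀ y, y ∉ M.V →
      perf M.Q y (Strategy.ofMap fstar hfstar) M.sumCost = value M.Q y M.sumCost)
    (hmin : ∀ x : M.V, (((M.Wstar g x).toReal : ℝ) : EReal) =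
      M.bellmanTerm g (fun x => (M.Wstar g x).toReal) (x, f x)) (y : State X) :
    M.lagCost g (y, M.glue f fstar y) +
      ∫⁻ y', value M.Q y' (M.lagCost g) ∂(M.Q (y, M.glue f fstar y)) ≤
        value M.Q y (M.lagCost g) := by
  by_cases hy : y ∈ M.V
  · have h := hmin ⟨y, hy⟩
    rw [coe_toReal_Wstar hsc hcost, bellmanTerm_Wstar hsc hcost,
      EReal.coe_ennreal_eq_coe_ennreal_iff] at h
    rw [show M.glue f fstar y = f ⟨y, hy⟩ from dif_pos hy]
    exact h.ge
  · rw [show M.glue f fstar y = fstar y from dif_neg hy]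
    have hc : Measurable M.sumCost := by
      rw [sumCost_eq_lagCost]
      exact (lowerSemicontinuous_lagCost hsc 1).measurable
    have h0 := M.sumCost_eq_zero_of_perf_eq hc hfstar hy (hopt y hy)
    rw [M.lagCost_eq_zero g h0, zero_add]
    rcases y with x | u
    · rw [lintegral_Q_inl M (w := fun y => value M.Q y (M.lagCost g)) (value_inr hsc g ()),
        M.eq_top_of_sumCost_eq_zero hcost h0]
      simp [disc]
    · rw [lintegral_Q_inr M (w := fun y => value M.Q y (M.lagCost g)) (value_inr hsc g ())]
      exact zero_le

end Model

end ImpulseControl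

open ImpulseControl
theorem lemma5p1
    {X A : Type*}
    [MetricSpace X] [SecondCountableTopology X] [MeasurableSpace X] [BorelSpace X]
    [StandardBorelSpace X] [Nonempty X]
    [MetricSpace A] [SecondCountableTopology A] [MeasurableSpace A] [BorelSpace A]
    [StandardBorelSpace A] [Nonempty A]
    {J : ℕ} (M : Model X A J)
    (hsc : IsSemicontinuous M.Q M.cost) (hcost : M.CostCondition)
    (g : Fin J → ℝ≥0) :
    -- `W*_g` is bounded, non-negative, lower semicontinuous and feasible
    ((∃ K : ℝ≥0, ∀ x : M.V, 0 ≤ M.Wstar g x ∧ M.Wstar g x ≤ K) ∧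
      LowerSemicontinuous (fun x : M.V => (M.Wstar g x).toReal) ∧
      M.DualFeasible g (fun x : M.V => (M.Wstar g x).toReal)) ∧
    -- it is the unique bounded lower semicontinuous solution of the Bellman equation
    (M.BellmanEq g (fun x : M.V => (M.Wstar g x).toReal) ∧
      ∀ W : M.V → ℝ, LowerSemicontinuous W → (∃ K : ℝ, ∀ x, |W x| ≤ K) → M.BellmanEq g W →
        W = fun x : M.V => (M.Wstar g x).toReal) ∧
    -- a measurable selector of minimizers is uniformly optimal
    (∀ (fstar : State X → Act A) (hfstar : Measurable fstar),
      (∀ x, x ∉ M.V →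
        perf M.Q x (Strategy.ofMap fstar hfstar) M.sumCost = value M.Q x M.sumCost) →
      ∀ (W : M.V → ℝ) (f : M.V → Act A), M.IsBddMeas W → Measurable f →
        M.BellmanEq g W →
        (∀ x : M.V, (W x : EReal) = M.bellmanTerm g W (x, f x)) →
        ∃ hF : Measurable (M.glue f fstar), ∀ x : State X,
          perf M.Q x (Strategy.ofMap (M.glue f fstar) hF) (M.cost 0) +
              ∑ j : Fin J, (g j : ℝ≥0∞) *
                perf M.Q x (Strategy.ofMap (M.glue f fstar) hF) (M.cost j.succ) =
            value M.Q x (M.lagCost g)) := by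
  refine ⟨⟨?_, Model.lowerSemicontinuous_Wstar hsc hcost g, Model.dualFeasible_Wstar hsc hcost g⟩,
    ⟨Model.bellmanEq_Wstar hsc hcost g, fun W hlsc hbdd hW => ?_⟩, ?_⟩
  · obtain ⟨K, hK⟩ := Model.exists_value_le hsc hcost g
    exact ⟨K, fun x => ⟨zero_le, hK x⟩⟩
  · exact Model.eq_Wstar_of_bellmanEq hsc hcost g ⟨hlsc.measurable, hbdd⟩ hW
  · intro fstar hfstar hopt W f hWm hf hW hmin
    obtain rfl := Model.eq_Wstar_of_bellmanEq hsc hcost g hWm hW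
    refine ⟨Model.measurable_glue hsc hf hfstar, fun x => ?_⟩
    rw [← M.perf_lagCost fun j => (hsc.lsc_cost j).measurable]
    refine le_antisymm ?_ (iInf_le _ _)
    exact perf_ofMap_le _ _ (Model.lowerSemicontinuous_lagCost hsc g).measurable
      (Model.lowerSemicontinuous_value hsc g).measurable
      (Model.glue_step_le_value hsc hcost g hfstar hopt hmin) x
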